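/- Let $K$ be a field, $m\ge 0$, and let $\Gamma$ be a tree on the vertex set $[m+1]=\{1,\dots,m+1\}$. Let $S$ be the polynomial ring over $K$ in the $2m$ indeterminates $x_{ij},x_{ji}$, $\{i,j\}\in E(\Gamma)$. List the $m$ edges of $\Gamma$ in any order, and let $A(\Gamma)$ be the $m\times(m+1)$ matrix over $S$ whose $k$-th row is $-x_{ij}e_i+x_{ji}e_j$ if $\{i,j\}$ is the $k$-th edge (in either of its orientations). Let $v_j$ be the minor of $A(\Gamma)$ obtained by omitting the $j$-th column, and let $I(\Gamma)=(v_1,\dots,v_{m+1})$, the generic monomial ideal attached to $\Gamma$. For a monomial ideal $I\subset S$ with minimal monomial generators $u_1,\dots,u_{m+1}$, let $U$ be the kernel of $S^{m+1}\to S$, $e_j\mapsto u_j$. The Taylor relations are the elements $\frac{u_i}{\gcd(u_i,u_j)}e_j-\frac{u_j}{\gcd(u_i,u_j)}e_i$ of $U$, $i<j$. A Hilbert--Burch matrix of $I$ is an $m\times(m+1)$ matrix whose rows are Taylor relations and form a basis of $U$. Its graph is the graph on $[m+1]$ in which $\{i,j\}$ is an edge if and only if the nonzero entries of some row are exactly the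 $i$-th and the $j$-th. A relation tree of $I$ is the graph of a Hilbert--Burch matrix of $I$, and $\mathcal T(I)$ is the set of all relation trees of $I$. Then each $v_j$ is, up to sign, a monomial $u_j$; the monomials $u_1,\dots,u_{m+1}$ are the (pairwise distinct) minimal monomial generators of $I(\Gamma)$; and, with this labelling of the generators, $$\mathcal T(I(\Gamma))=\{\Gamma\}.$$ -/

import Mathlib

open MvPolynomial

noncomputable section

/-- The monomials with exponent vectors `u 0, …, u m` are the minimal monomial generators of the
ideal `I` (they generate `I`, and none of them divides another), labelled by `Fin (m + 1)`. -/
structure IsMinimalMonomialGenerators {K σ : Type*} [Field K] {m : ℕ}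
    (I : Ideal (MvPolynomial σ K)) (u : Fin (m + 1) → σ →₀ ℕ) : Prop where
  span_eq : I = Ideal.span (Set.range fun j => monomial (u j) (1 : K))
  antichain : ∀ i j, u i ≤ u j → i = j

/-- The first syzygy module of the monomials with exponents `u`: the kernel of
`S ^ (m + 1) → S`, `e_j ↦ x ^ (u j)`, where `S` is the polynomial ring. -/
def relationModule (K : Type*) {σ : Type*} [Field K] {m : ℕ} (u : Fin (m + 1) → σ →₀ ℕ) :
    Submodule (MvPolynomial σ K) (Fin (m + 1) → MvPolynomial σ K) :=
  LinearMap.ker (Fintype.linearCombination (MvPolynomial σ K)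
    (fun j => monomial (u j) (1 : K)))

/-- The Taylor relation `u_{ji} e_j - u_{ij} e_i`, with `u_{ji} = u_i / gcd (u_i, u_j)` and
`u_{ij} = u_j / gcd (u_i, u_j)`. -/
def taylorRelation (K : Type*) {σ : Type*} [Field K] {m : ℕ} (u : Fin (m + 1) → σ →₀ ℕ)
    (i j : Fin (m + 1)) : Fin (m + 1) → MvPolynomial σ K :=
  Pi.single j (monomial (u i - u i ⊓ u j) (1 : K))
    - Pi.single i (monomial (u j - u i ⊓ u j) (1 : K))

/-- A Hilbert--Burch matrix for the monomials with exponents `u`: its `m` rows are Taylor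
relations and they form a basis of the syzygy module, that is,
`0 → S ^ m → S ^ (m + 1) → S` is exact, the first map being given by `A`. -/
structure IsHilbertBurchMatrix {K σ : Type*} [Field K] {m : ℕ} (u : Fin (m + 1) → σ →₀ ℕ)
    (A : Matrix (Fin m) (Fin (m + 1)) (MvPolynomial σ K)) : Prop where
  row_taylor : ∀ k, ∃ i j, i < j ∧ A k = taylorRelation K u i j
  linearIndependent : LinearIndependent (MvPolynomial σ K) (fun k => A k)
  span_eq : Submodule.span (MvPolynomial σ K) (Set.range fun k => A k) = relationModule K u

/-- The graph in which `{i, j}` is an edge iff the nonzero entries of some row of `A` are exactly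
the `i`-th and the `j`-th ones. -/
def relationGraph {R : Type*} [Zero R] {m : ℕ} (A : Matrix (Fin m) (Fin (m + 1)) R) :
    SimpleGraph (Fin (m + 1)) where
  Adj i j := i ≠ j ∧ ∃ k, ∀ l, A k l ≠ 0 ↔ l = i ∨ l = j
  symm := ⟨fun _ _ h => ⟨h.1.symm, h.2.imp fun _ hk l => (hk l).trans or_comm⟩⟩
  loopless := ⟨fun _ h => h.1 rfl⟩

/-- The set of all relation trees of the monomial ideal `I`, whose minimal monomial generators are
labelled by `Fin (m + 1)` through their exponents `u`. -/
def relationTrees {K σ : Type*} [Field K] {m : ℕ} (I : Ideal (MvPolynomial σ K))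
    (u : Fin (m + 1) → σ →₀ ℕ) : Set (SimpleGraph (Fin (m + 1))) :=
  {G | IsMinimalMonomialGenerators I u ∧
    ∃ A : Matrix (Fin m) (Fin (m + 1)) (MvPolynomial σ K),
      IsHilbertBurchMatrix u A ∧ G = relationGraph A}

/-- `d` lists every edge of `Γ` exactly once, each with some orientation. -/
def IsEdgeOrdering {m : ℕ} {Γ : SimpleGraph (Fin (m + 1))} (d : Fin m → Γ.Dart) : Prop :=
  Function.Bijective fun k => (⟨(d k).edge, (d k).edge_mem⟩ : Γ.edgeSet)

/-- The generic matrix of `Γ`. The indeterminate `x_{ij}` is indexed by the dart from `i` to `j`;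
if the `k`-th edge is `{i, j}`, listed as the dart from `i` to `j`, then the `k`-th row is
`-x_{ij} e_i + x_{ji} e_j`. -/
def genericMatrix (K : Type*) [Field K] {m : ℕ} {Γ : SimpleGraph (Fin (m + 1))}
    (d : Fin m → Γ.Dart) : Matrix (Fin m) (Fin (m + 1)) (MvPolynomial Γ.Dart K) :=
  fun k l => if l = (d k).fst then -X (d k) else if l = (d k).snd then X (d k).symm else 0

/-- The minor of the generic matrix obtained by omitting the `j`-th column. -/
def genericMinor (K : Type*) [Field K] {m : ℕ} {Γ : SimpleGraph (Fin (m + 1))}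
    (d : Fin m → Γ.Dart) (j : Fin (m + 1)) : MvPolynomial Γ.Dart K :=
  ((genericMatrix K d).submatrix id j.succAbove).det

/-- The generic monomial ideal attached to `Γ`: the ideal of maximal minors of the generic
matrix. -/
def genericIdeal (K : Type*) [Field K] {m : ℕ} {Γ : SimpleGraph (Fin (m + 1))}
    (d : Fin m → Γ.Dart) : Ideal (MvPolynomial Γ.Dart K) :=
  Ideal.span (Set.range (genericMinor K d))

end

/-! Deleting an edge of a tree leaves two sides, so each edge has exactly one orientation towards a
vertex `j`. After column `j` is omitted, the only transversal with nonzero entries sends each edge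
to its tail in that orientation; hence `v_j` is, up to sign, the product of the `x_e` over the darts
`e` pointing towards `j` (`exists_genericMinor_eq`).

For an edge `e` the end monomials satisfy `u_fst * x_e = u_snd * x_{e.symm}`, both sides being their
lcm, so the rows are Taylor relations up to sign. They are independent because a maximal minor is
nonzero. They generate the syzygies (`span_genericMatrix`): a relation of multidegree `a` between
two vertices telescopes along the path joining them, whose vertices all have monomials dividing
`x^a`.

Uniqueness: only the two ends of an edge have monomials dividing the lcm of that edge, so every
Hilbert–Burch matrix contains the Taylor relation of each edge
(`exists_taylorRelation_of_mem_span`). With `m` edges and `m` rows, nothing else fits. -/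

noncomputable section

/-! ### Darts pointing towards a vertex, and the monomials they define. -/

namespace SimpleGraph

/-- The dart `e` points towards `v` if `v` is on the same side of the edge of `e` as its head. -/
def Dart.PointsTo {V : Type*} {G : SimpleGraph V} (e : G.Dart) (v : V) : Prop :=
  (G.deleteEdges {e.edge}).Reachable e.snd v

variable {V : Type*} {G : SimpleGraph V}

lemma Dart.pointsTo_snd (e : G.Dart) : e.PointsTo e.snd := Reachable.refl _

lemma Dart.symm_pointsTo_fst (e : G.Dart) : e.symm.PointsTo e.fst := Reachable.refl _

lemma IsAcyclic.not_pointsTo_fst (hG : G.IsAcyclic) (e : G.Dart) : ¬ e.PointsTo e.fst := fun h =>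
  isAcyclic_iff_forall_isBridge.1 hG e.edge_mem h.symm

lemma Dart.PointsTo.of_adj {e : G.Dart} {v w : V} (h : e.PointsTo v) (hvw : G.Adj v w)
    (hne : s(v, w) ≠ e.edge) : e.PointsTo w :=
  Reachable.trans h (Adj.reachable (by simp [hvw, hne]))

lemma Dart.pointsTo_congr {e : G.Dart} {v w : V} (hvw : G.Adj v w) (hne : s(v, w) ≠ e.edge) :
    e.PointsTo v ↔ e.PointsTo w :=
  ⟨fun h => h.of_adj hvw hne, fun h => h.of_adj hvw.symm (by rwa [Sym2.eq_swap])⟩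

lemma IsAcyclic.not_pointsTo_symm (hG : G.IsAcyclic) {e : G.Dart} {v : V} (h : e.PointsTo v) :
    ¬ e.symm.PointsTo v := fun h' => by
  unfold Dart.PointsTo at h h'
  rw [Dart.edge_symm] at h'
  exact hG.not_pointsTo_fst e (h.trans h'.symm)

lemma Connected.pointsTo_or_symm (hG : G.Connected) (e : G.Dart) (v : V) :
    e.PointsTo v ∨ e.symm.PointsTo v := by
  obtain ⟨p⟩ := hG.preconnected v e.snd
  generalize hx : e.snd = x at p
  induction p with
  | nil => exact .inl (hx ▸ e.pointsTo_snd)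
  | @cons v w _ h p ih =>
    by_cases hne : s(v, w) = e.edge
    · rcases Sym2.eq_iff.1 hne with ⟨rfl, -⟩ | ⟨rfl, -⟩
      exacts [.inr e.symm_pointsTo_fst, .inl e.pointsTo_snd]
    · rw [Dart.pointsTo_congr h hne, Dart.pointsTo_congr (e := e.symm) h (by simpa using hne)]
      exact ih hx

lemma IsTree.not_pointsTo_iff (hG : G.IsTree) {e : G.Dart} {v : V} :
    ¬ e.PointsTo v ↔ e.symm.PointsTo v :=
  ⟨(hG.connected.pointsTo_or_symm e v).resolve_left, fun h h' => hG.isAcyclic.not_pointsTo_symm h' h⟩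

lemma Connected.exists_pointsTo (hG : G.Connected) {v w : V} (hne : v ≠ w) :
    ∃ e : G.Dart, e.fst = v ∧ e.PointsTo w ∧ G.dist e.snd w < G.dist v w := by
  obtain ⟨p, hp, hlen⟩ := hG.exists_path_of_dist v w
  cases p with
  | nil => exact absurd rfl hne
  | @cons _ x _ h p =>
    rw [Walk.cons_isPath_iff] at hp
    refine ⟨⟨(v, x), h⟩, rfl, ?_, ?_⟩
    -- The rest of a path never returns to `v`, so it avoids the first edge.
    · exact ⟨p.toDeleteEdge s(v, x) fun he => hp.2 (p.fst_mem_support_of_mem_edges he)⟩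
    · rw [← hlen, Walk.length_cons]
      exact Nat.lt_succ_of_le (dist_le p)

variable [Finite V]

instance : Finite G.Dart := Finite.of_injective _ Dart.toProd_injective

open Classical in
/-- The set of darts pointing towards `v`, as the exponent of a squarefree monomial. -/
def pointingExponent (G : SimpleGraph V) (v : V) : G.Dart →₀ ℕ :=
  Finsupp.equivFunOnFinite.symm fun e => if e.PointsTo v then 1 else 0

open Classical in
lemma pointingExponent_apply (v : V) (e : G.Dart) :
    G.pointingExponent v e = if e.PointsTo v then 1 else 0 := rfl

/-- The ends of `e` lie on the same side of every other edge, so the two exponents differ only at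
`e` and `e.symm`. -/
lemma IsAcyclic.pointingExponent_add_single (hG : G.IsAcyclic) (e : G.Dart) :
    G.pointingExponent e.fst + Finsupp.single e 1
      = G.pointingExponent e.snd + Finsupp.single e.symm 1 := by
  classical
  ext f
  simp only [Finsupp.add_apply, pointingExponent_apply, Finsupp.single_apply]
  by_cases h1 : e = f
  · subst h1
    simp [hG.not_pointsTo_fst, e.pointsTo_snd, e.symm_ne]
  by_cases h2 : e.symm = f
  · subst h2
    simp [e.symm_ne.symm, e.symm_pointsTo_fst,
      show ¬ e.symm.PointsTo e.snd from hG.not_pointsTo_fst e.symm]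
  rw [Dart.pointsTo_congr e.adj (e := f)]
  · simp [h1, h2]
  · intro h
    rcases (dart_edge_eq_iff e f).1 h with h | h
    · exact h1 h
    · exact h2 (by simp [h])

lemma IsAcyclic.inf_pointingExponent_add_single (hG : G.IsAcyclic) (e : G.Dart) :
    G.pointingExponent e.fst ⊓ G.pointingExponent e.snd + Finsupp.single e 1
      = G.pointingExponent e.snd := by
  classical
  have key := hG.pointingExponent_add_single e
  ext f
  have h := DFunLike.congr_fun key f
  simp only [Finsupp.add_apply, Finsupp.inf_apply, Finsupp.single_apply] at h ⊢
  by_cases h1 : e = f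
  · subst h1
    simp only [e.symm_ne, if_true, if_false] at h ⊢
    omega
  · simp only [h1, if_false] at h ⊢
    omega

lemma IsTree.eq_of_pointingExponent_le (hG : G.IsTree) {v w : V}
    (h : G.pointingExponent v ≤ G.pointingExponent w) : v = w := by
  by_contra hne
  obtain ⟨e, rfl, he, -⟩ := hG.connected.exists_pointsTo hne
  have := h e.symm
  rw [pointingExponent_apply, pointingExponent_apply, if_pos e.symm_pointsTo_fst,
    if_neg (hG.isAcyclic.not_pointsTo_symm he)] at this
  omega

/-- If `e` is the first dart from `v` towards `f.fst`, then `e.symm` points to `v` but not to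
`f.fst`. The only extra variable allowed is `f`, which forces `e.symm = f`. -/
lemma IsTree.eq_or_eq_of_pointingExponent_le (hG : G.IsTree) {v : V} {f : G.Dart}
    (h : G.pointingExponent v ≤ G.pointingExponent f.fst + Finsupp.single f 1) :
    v = f.fst ∨ v = f.snd := by
  classical
  by_contra! hne
  obtain ⟨e, rfl, he, -⟩ := hG.connected.exists_pointsTo hne.1
  have := h e.symm
  rw [Finsupp.add_apply, pointingExponent_apply, pointingExponent_apply,
    if_pos e.symm_pointsTo_fst, if_neg (hG.isAcyclic.not_pointsTo_symm he),
    Finsupp.single_apply] at this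
  split_ifs at this with h'
  · exact hne.2 (by rw [h']; rfl)
  · omega

/-- One step of the telescoping: the first dart towards `w` occurs in the monomial of `w`, so the
lcm for that edge still divides `x^a`. -/
lemma IsTree.exists_dart_le (hG : G.IsTree) {v w : V} (hne : v ≠ w) {a : G.Dart →₀ ℕ}
    (hv : G.pointingExponent v ≤ a) (hw : G.pointingExponent w ≤ a) :
    ∃ e : G.Dart, e.fst = v ∧ G.dist e.snd w < G.dist v w ∧
      G.pointingExponent e.fst + Finsupp.single e 1 ≤ a := by
  classical
  obtain ⟨e, rfl, he, hd⟩ := hG.connected.exists_pointsTo hne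
  refine ⟨e, rfl, hd, fun f => ?_⟩
  rw [Finsupp.add_apply, Finsupp.single_apply]
  split_ifs with h
  · subst h
    rw [pointingExponent_apply, if_neg (hG.isAcyclic.not_pointsTo_fst e)]
    simpa [pointingExponent_apply, he] using hw e
  · exact hv f

end SimpleGraph

/-! ### Syzygies of monomials and Taylor relations. -/

section Syzygies

variable {K σ : Type*} [Field K] {m : ℕ}

lemma single_mul_mem_relationModule (u : Fin (m + 1) → σ →₀ ℕ) {i j : Fin (m + 1)}
    {a b : σ →₀ ℕ} (h : a + u i = b + u j) :
    Pi.single i (monomial a 1) - Pi.single j (monomial b 1) ∈ relationModule K u := by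
  simp [relationModule, map_sub, Fintype.linearCombination_apply_single, monomial_mul, h]

/-- A submodule containing all the multigraded differences of basis elements contains
the syzygy module. -/
lemma relationModule_le (u : Fin (m + 1) → σ →₀ ℕ)
    (N : Submodule (MvPolynomial σ K) (Fin (m + 1) → MvPolynomial σ K))
    (h : ∀ i j a, u i ≤ a → u j ≤ a → (Pi.single i (monomial (a - u i) 1)
      - Pi.single j (monomial (a - u j) 1) : Fin (m + 1) → MvPolynomial σ K) ∈ N) :
    relationModule K u ≤ N := by
  classical
  -- A chosen generator dividing `x^a`; the default `0` is irrelevant. The map `G` lifts monomials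
  -- through these choices, and modulo `N` every vector agrees with the lift of its image, so
  -- syzygies vanish modulo `N`.
  let r : (σ →₀ ℕ) → Fin (m + 1) := fun a => if h : ∃ i, u i ≤ a then h.choose else 0
  have hr : ∀ i a, u i ≤ a → u (r a) ≤ a := fun i a hi => by
    have h : ∃ i, u i ≤ a := ⟨i, hi⟩
    simp only [r, dif_pos h]
    exact h.choose_spec
  let G : MvPolynomial σ K →ₗ[K] (Fin (m + 1) → MvPolynomial σ K) :=
    (basisMonomials σ K).constr K fun a => Pi.single (r a) (monomial (a - u (r a)) 1)
  have hG : ∀ a, G (monomial a 1) = Pi.single (r a) (monomial (a - u (r a)) 1) := fun a => by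
    have := (basisMonomials σ K).constr_basis K
      (fun a => (Pi.single (r a) (monomial (a - u (r a)) 1) : Fin (m + 1) → MvPolynomial σ K)) a
    rwa [coe_basisMonomials] at this
  have key : N.mkQ.restrictScalars K = N.mkQ.restrictScalars K ∘ₗ G ∘ₗ
      (Fintype.linearCombination (MvPolynomial σ K)
        (fun j => monomial (u j) (1 : K))).restrictScalars K := by
    refine LinearMap.pi_ext' fun j => (basisMonomials σ K).ext fun b => ?_
    rw [coe_basisMonomials]
    simp only [LinearMap.comp_apply, LinearMap.restrictScalars_apply, LinearMap.single_apply,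
      Fintype.linearCombination_apply_single, smul_eq_mul, monomial_mul, mul_one, hG,
      Submodule.mkQ_apply]
    rw [Submodule.Quotient.eq]
    have := h j (r (b + u j)) (b + u j) le_add_self (hr j _ le_add_self)
    rwa [add_tsub_cancel_right] at this
  intro f hf
  have := LinearMap.congr_fun key f
  simp only [LinearMap.comp_apply, LinearMap.restrictScalars_apply] at this
  rw [LinearMap.mem_ker.1 hf, map_zero, map_zero, Submodule.mkQ_apply,
    Submodule.Quotient.mk_eq_zero] at this
  exact this

lemma taylorRelation_apply_ne_zero_iff (u : Fin (m + 1) → σ →₀ ℕ) {i j : Fin (m + 1)}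
    (hij : i ≠ j) (l : Fin (m + 1)) : taylorRelation K u i j l ≠ 0 ↔ l = i ∨ l = j := by
  rcases eq_or_ne l i with rfl | hi
  · simp [taylorRelation, hij]
  rcases eq_or_ne l j with rfl | hj
  · simp [taylorRelation, hi]
  · simp [taylorRelation, hi, hj]

/-- If `i` and `j` are the only generators dividing `x ^ (s + u i)`, then a relation whose `i`-th
entry involves `x ^ s` cannot be generated without a Taylor relation between `i` and `j`. -/
lemma exists_taylorRelation_of_mem_span {ι : Type*} (u : Fin (m + 1) → σ →₀ ℕ)
    {i j : Fin (m + 1)} {s : σ →₀ ℕ} (hs : ∀ l, u l ≤ u i + s → l = i ∨ l = j)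
    {A : ι → Fin (m + 1) → MvPolynomial σ K}
    (hA : ∀ k, ∃ i j, i < j ∧ A k = taylorRelation K u i j)
    {f : Fin (m + 1) → MvPolynomial σ K}
    (hf : f ∈ Submodule.span (MvPolynomial σ K) (Set.range A)) (hc : coeff s (f i) ≠ 0) :
    ∃ k, ∀ l, A k l ≠ 0 ↔ l = i ∨ l = j := by
  classical
  by_contra hk
  rw [not_exists] at hk
  -- A nonzero coefficient would make `u_l / gcd(u_i, u_l)` divide `x^s`, hence `u_l` divide `x^(s +
  -- u i)`.
  have hvanish : ∀ p l, l ≠ j → l ≠ i → coeff s (p * monomial (u l - u i ⊓ u l) (1 : K)) = 0 := by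
    intro p l hj hi
    rw [coeff_mul_monomial', if_neg]
    intro hle
    refine (hs l fun x => ?_).elim hi hj
    have := hle x
    simp only [Finsupp.add_apply, Finsupp.tsub_apply, Finsupp.inf_apply] at this ⊢
    omega
  have hrow : ∀ k p, coeff s (p * A k i) = 0 := by
    intro k p
    obtain ⟨a, b, hab, hAk⟩ := hA k
    have hne : ¬ ∀ l, (l = a ∨ l = b) ↔ l = i ∨ l = j := fun h =>
      hk k fun l => by rw [hAk, taylorRelation_apply_ne_zero_iff u hab.ne, h l]
    rw [hAk]
    by_cases hia : i = a
    · subst hia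
      have hb : b ≠ j := fun h => hne fun l => by rw [h]
      simpa [taylorRelation, hab.ne] using hvanish p b hb hab.ne'
    by_cases hib : i = b
    · subst hib
      have ha : a ≠ j := fun h => hne fun l => by rw [h, or_comm]
      simpa [taylorRelation, hab.ne', inf_comm] using hvanish p a ha hab.ne
    · simp [taylorRelation, hia, hib]
  obtain ⟨c, rfl⟩ := (Finsupp.mem_span_range_iff_exists_finsupp).1 hf
  apply hc
  simp only [Finsupp.sum, Finset.sum_apply, Pi.smul_apply, smul_eq_mul, coeff_sum, hrow,
    Finset.sum_const_zero]

end Syzygies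

/-! ### Matching the edges with the vertices other than a given one. -/

section GenericMatrix

variable {m : ℕ} {Γ : SimpleGraph (Fin (m + 1))}

lemma IsEdgeOrdering.exists_edge_eq {d : Fin m → Γ.Dart} (hd : IsEdgeOrdering d) (f : Γ.Dart) :
    ∃ k, (d k).edge = f.edge := by
  obtain ⟨k, hk⟩ := hd.2 ⟨f.edge, f.edge_mem⟩
  exact ⟨k, congrArg Subtype.val hk⟩

lemma IsEdgeOrdering.eq_of_edge_eq {d : Fin m → Γ.Dart} (hd : IsEdgeOrdering d) {k l : Fin m}
    (h : (d k).edge = (d l).edge) : k = l :=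
  hd.1 (Subtype.ext h)

open Classical in
/-- The edges listed by `d`, oriented towards the vertex `j`. -/
def orientTowards (d : Fin m → Γ.Dart) (j : Fin (m + 1)) (k : Fin m) : Γ.Dart :=
  if (d k).PointsTo j then d k else (d k).symm

lemma orientTowards_eq_or (d : Fin m → Γ.Dart) (j : Fin (m + 1)) (k : Fin m) :
    orientTowards d j k = d k ∨ orientTowards d j k = (d k).symm := by
  unfold orientTowards
  split_ifs <;> simp

lemma orientTowards_edge (d : Fin m → Γ.Dart) (j : Fin (m + 1)) (k : Fin m) :
    (orientTowards d j k).edge = (d k).edge := by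
  rcases orientTowards_eq_or d j k with h | h <;> simp [h]

lemma orientTowards_pointsTo (hΓ : Γ.IsTree) (d : Fin m → Γ.Dart) (j : Fin (m + 1)) (k : Fin m) :
    (orientTowards d j k).PointsTo j := by
  unfold orientTowards
  split_ifs with h
  exacts [h, hΓ.not_pointsTo_iff.1 h]

lemma orientTowards_fst_ne (hΓ : Γ.IsTree) (d : Fin m → Γ.Dart) (j : Fin (m + 1)) (k : Fin m) :
    (orientTowards d j k).fst ≠ j := fun h =>
  hΓ.isAcyclic.not_pointsTo_fst (orientTowards d j k)
    (by rw [h]; exact orientTowards_pointsTo hΓ d j k)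

lemma exists_orientTowards_eq (hΓ : Γ.IsTree) {d : Fin m → Γ.Dart} (hd : IsEdgeOrdering d)
    {j : Fin (m + 1)} {f : Γ.Dart} (hf : f.PointsTo j) : ∃ k, orientTowards d j k = f := by
  obtain ⟨k, hk⟩ := hd.exists_edge_eq f
  refine ⟨k, ?_⟩
  rw [← orientTowards_edge d j] at hk
  refine ((SimpleGraph.dart_edge_eq_iff _ _).1 hk).resolve_right fun h => ?_
  have := orientTowards_pointsTo hΓ d j k
  rw [h] at this
  exact hΓ.isAcyclic.not_pointsTo_symm hf this

/-- In a tree, taking the tails of the edges oriented towards `j` matches the edges with the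
vertices other than `j`. -/
lemma exists_perm_orientTowards (hΓ : Γ.IsTree) {d : Fin m → Γ.Dart} (hd : IsEdgeOrdering d)
    (j : Fin (m + 1)) :
    ∃ e : Equiv.Perm (Fin m), ∀ k, j.succAbove (e k) = (orientTowards d j k).fst := by
  have h : ∀ k, ∃ l, j.succAbove l = (orientTowards d j k).fst := fun k =>
    Fin.exists_succAbove_eq (orientTowards_fst_ne hΓ d j k)
  choose g hg using h
  have hsurj : Function.Surjective g := fun l => by
    obtain ⟨f, hf, hfj, -⟩ := hΓ.connected.exists_pointsTo (Fin.succAbove_ne j l)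
    obtain ⟨k, rfl⟩ := exists_orientTowards_eq hΓ hd hfj
    exact ⟨k, Fin.succAbove_right_injective (p := j) (by rw [hg, hf])⟩
  exact ⟨Equiv.ofBijective g ⟨Finite.injective_iff_surjective.2 hsurj, hsurj⟩, hg⟩

lemma orientTowards_fst_injective (hΓ : Γ.IsTree) {d : Fin m → Γ.Dart} (hd : IsEdgeOrdering d)
    (j : Fin (m + 1)) : Function.Injective fun k => (orientTowards d j k).fst := by
  obtain ⟨e, he⟩ := exists_perm_orientTowards hΓ hd j
  simp only [← he]
  exact Fin.succAbove_right_injective.comp e.injective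

lemma exists_orientTowards_fst_eq (hΓ : Γ.IsTree) {d : Fin m → Γ.Dart} (hd : IsEdgeOrdering d)
    {i j : Fin (m + 1)} (hij : i ≠ j) : ∃ k, (orientTowards d j k).fst = i ∧
      Γ.dist (orientTowards d j k).snd j < Γ.dist i j := by
  obtain ⟨f, rfl, hfj, hlt⟩ := hΓ.connected.exists_pointsTo hij
  obtain ⟨k, rfl⟩ := exists_orientTowards_eq hΓ hd hfj
  exact ⟨k, rfl, hlt⟩

lemma dist_orientTowards_snd_lt (hΓ : Γ.IsTree) {d : Fin m → Γ.Dart} (hd : IsEdgeOrdering d)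
    (j : Fin (m + 1)) (k : Fin m) :
    Γ.dist (orientTowards d j k).snd j < Γ.dist (orientTowards d j k).fst j := by
  obtain ⟨l, hl, hlt⟩ := exists_orientTowards_fst_eq hΓ hd (orientTowards_fst_ne hΓ d j k)
  rwa [orientTowards_fst_injective hΓ hd j hl] at hlt

/-- The matching of edges with the vertices other than `j` is unique. -/
lemma eq_of_forall_mem_orientTowards (hΓ : Γ.IsTree) {d : Fin m → Γ.Dart} (hd : IsEdgeOrdering d)
    {j : Fin (m + 1)} {s : Fin m → Fin m} (hs : Function.Injective s)
    (h : ∀ k, j.succAbove (s k) = (orientTowards d j k).fst ∨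
      j.succAbove (s k) = (orientTowards d j k).snd) (k : Fin m) :
    j.succAbove (s k) = (orientTowards d j k).fst := by
  -- If `k` took its head, that head would be the tail of an edge `l` closer to `j`, which already
  -- takes it by induction; injectivity of `s` rules this out.
  induction hn : Γ.dist (orientTowards d j k).fst j using Nat.strong_induction_on generalizing k with
  | _ n ih =>
    refine (h k).resolve_right fun hsnd => ?_
    have hne : (orientTowards d j k).snd ≠ j := hsnd ▸ Fin.succAbove_ne j _
    obtain ⟨l, hl, -⟩ := exists_orientTowards_fst_eq hΓ hd hne
    have hlt := dist_orientTowards_snd_lt hΓ hd j k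
    rw [hn, ← hl] at hlt
    have hlk := ih _ hlt l rfl
    rw [hl, ← hsnd] at hlk
    obtain rfl := hs (Fin.succAbove_right_injective hlk)
    exact (orientTowards d j l).fst_ne_snd hl

lemma sum_single_orientTowards (hΓ : Γ.IsTree) {d : Fin m → Γ.Dart} (hd : IsEdgeOrdering d)
    (j : Fin (m + 1)) :
    ∑ k, Finsupp.single (orientTowards d j k) 1 = Γ.pointingExponent j := by
  classical
  ext f
  rw [Finsupp.finsetSum_apply, SimpleGraph.pointingExponent_apply]
  simp only [Finsupp.single_apply]
  split_ifs with hf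
  · obtain ⟨k, rfl⟩ := exists_orientTowards_eq hΓ hd hf
    rw [Finset.sum_eq_single k _ (by simp), if_pos rfl]
    exact fun l _ hl => if_neg fun h => hl (orientTowards_fst_injective hΓ hd j (by simp only [h]))
  · exact Finset.sum_eq_zero fun k _ => if_neg fun h =>
      hf (by rw [← h]; exact orientTowards_pointsTo hΓ d j k)

/-! ### Minors, syzygies and relation trees of the generic matrix. -/

variable (K : Type*) [Field K]

lemma genericMatrix_row (d : Fin m → Γ.Dart) (k : Fin m) :
    genericMatrix K d k = Pi.single (d k).snd (X (d k).symm) - Pi.single (d k).fst (X (d k)) := by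
  ext1 l
  have := (d k).fst_ne_snd
  by_cases h1 : l = (d k).fst
  · subst h1
    simp [genericMatrix, this]
  · by_cases h2 : l = (d k).snd
    · subst h2
      simp [genericMatrix, h1]
    · simp [genericMatrix, h1, h2]

lemma genericMatrix_ne_zero {d : Fin m → Γ.Dart} {k : Fin m} {l : Fin (m + 1)}
    (h : genericMatrix K d k l ≠ 0) (j : Fin (m + 1)) :
    l = (orientTowards d j k).fst ∨ l = (orientTowards d j k).snd := by
  have : l = (d k).fst ∨ l = (d k).snd := by
    by_contra! h'
    simp [genericMatrix, h'] at h
  rcases orientTowards_eq_or d j k with h | h <;> rw [h]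
  exacts [this, this.symm]

lemma genericMatrix_orientTowards (d : Fin m → Γ.Dart) (j : Fin (m + 1)) (k : Fin m) :
    ∃ c : ℤˣ, genericMatrix K d k (orientTowards d j k).fst = c • X (orientTowards d j k) := by
  rcases orientTowards_eq_or d j k with h | h <;> rw [h]
  · exact ⟨-1, by simp [genericMatrix]⟩
  · exact ⟨1, by simp [genericMatrix, (d k).fst_ne_snd.symm]⟩

theorem exists_genericMinor_eq (hΓ : Γ.IsTree) {d : Fin m → Γ.Dart} (hd : IsEdgeOrdering d)
    (j : Fin (m + 1)) :
    ∃ c : ℤˣ, genericMinor K d j = c • monomial (Γ.pointingExponent j) 1 := by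
  classical
  obtain ⟨e, he⟩ := exists_perm_orientTowards hΓ hd j
  choose c hc using genericMatrix_orientTowards K d j
  refine ⟨Equiv.Perm.sign e * ∏ k, c k, ?_⟩
  rw [genericMinor, ← Matrix.det_transpose, Matrix.det_apply, Finset.sum_eq_single e]
  · simp only [Matrix.transpose_apply, Matrix.submatrix_apply, id, he, hc, mul_smul]
    rw [← sum_single_orientTowards hΓ hd j, monomial_sum_one, Finset.prod_smul]
    rfl
  · intro s _ hs
    rw [Finset.prod_eq_zero_iff.2 ?_, smul_zero]
    by_contra! h
    refine hs (Equiv.ext fun k => Fin.succAbove_right_injective (p := j) ?_)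
    rw [he]
    exact eq_of_forall_mem_orientTowards hΓ hd s.injective
      (fun k => genericMatrix_ne_zero K (h k (Finset.mem_univ k)) j) k
  · simp

lemma linearIndependent_genericMatrix (hΓ : Γ.IsTree) {d : Fin m → Γ.Dart}
    (hd : IsEdgeOrdering d) :
    LinearIndependent (MvPolynomial Γ.Dart K) fun k => genericMatrix K d k := by
  have h : genericMinor K d 0 ≠ 0 := by
    obtain ⟨c, hc⟩ := exists_genericMinor_eq K hΓ hd 0
    rw [hc, Ne, smul_eq_zero_iff_eq, monomial_eq_zero]
    exact one_ne_zero
  exact LinearIndependent.of_comp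
    (LinearMap.funLeft (MvPolynomial Γ.Dart K) (MvPolynomial Γ.Dart K) (Fin.succAbove 0))
    (Matrix.linearIndependent_rows_of_det_ne_zero h)

lemma genericMatrix_mem_relationModule (hΓ : Γ.IsTree) (d : Fin m → Γ.Dart) (k : Fin m) :
    genericMatrix K d k ∈ relationModule K Γ.pointingExponent := by
  rw [genericMatrix_row]
  refine single_mul_mem_relationModule _ ?_
  rw [add_comm (Finsupp.single _ _), ← hΓ.isAcyclic.pointingExponent_add_single,
    add_comm (Finsupp.single _ _)]

/-- The relation of multidegree `a` between the ends of an edge is a multiple of a row. -/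
lemma single_sub_single_mem_span_genericMatrix (hΓ : Γ.IsTree) {d : Fin m → Γ.Dart}
    (hd : IsEdgeOrdering d) (e : Γ.Dart) {a : Γ.Dart →₀ ℕ}
    (ha : Γ.pointingExponent e.fst + Finsupp.single e 1 ≤ a) :
    (Pi.single e.fst (monomial (a - Γ.pointingExponent e.fst) 1)
      - Pi.single e.snd (monomial (a - Γ.pointingExponent e.snd) 1) :
        Fin (m + 1) → MvPolynomial Γ.Dart K) ∈
      Submodule.span (MvPolynomial Γ.Dart K) (Set.range (genericMatrix K d)) := by
  obtain ⟨b, rfl⟩ := exists_add_of_le ha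
  have h1 : Γ.pointingExponent e.fst + Finsupp.single e 1 + b - Γ.pointingExponent e.fst
      = b + Finsupp.single e 1 := by
    rw [add_assoc, add_tsub_cancel_left, add_comm b]
  have h2 : Γ.pointingExponent e.fst + Finsupp.single e 1 + b - Γ.pointingExponent e.snd
      = b + Finsupp.single e.symm 1 := by
    rw [hΓ.isAcyclic.pointingExponent_add_single, add_assoc, add_tsub_cancel_left, add_comm b]
  rw [h1, h2]
  obtain ⟨k, hk⟩ := hd.exists_edge_eq e
  have hmem := Submodule.smul_mem _ (monomial b (1 : K))
    (Submodule.subset_span (R := MvPolynomial Γ.Dart K) (Set.mem_range_self (f := genericMatrix K d) k))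
  rw [genericMatrix_row, smul_sub, ← Pi.single_smul, ← Pi.single_smul, smul_eq_mul, smul_eq_mul,
    X, X, monomial_mul, monomial_mul, mul_one] at hmem
  rcases (SimpleGraph.dart_edge_eq_iff _ _).1 hk with h | h
  · rw [h] at hmem
    rw [← neg_sub]
    exact Submodule.neg_mem _ hmem
  · rw [h, SimpleGraph.Dart.symm_symm] at hmem
    exact hmem

theorem span_genericMatrix (hΓ : Γ.IsTree) {d : Fin m → Γ.Dart} (hd : IsEdgeOrdering d) :
    Submodule.span (MvPolynomial Γ.Dart K) (Set.range (genericMatrix K d))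
      = relationModule K Γ.pointingExponent := by
  refine le_antisymm (Submodule.span_le.2 ?_) (relationModule_le _ _ ?_)
  · rintro _ ⟨k, rfl⟩
    exact genericMatrix_mem_relationModule K hΓ d k
  · intro i j a hi hj
    induction hn : Γ.dist i j using Nat.strong_induction_on generalizing i with
    | _ n ih =>
      rcases eq_or_ne i j with rfl | hij
      · simp
      obtain ⟨e, rfl, hlt, he⟩ := hΓ.exists_dart_le hij hi hj
      have hsnd : Γ.pointingExponent e.snd ≤ a := by
        rw [hΓ.isAcyclic.pointingExponent_add_single] at he
        exact le_self_add.trans he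
      have := Submodule.add_mem _ (single_sub_single_mem_span_genericMatrix K hΓ hd e he)
        (ih _ (hn ▸ hlt) e.snd hsnd rfl)
      rwa [sub_add_sub_cancel] at this

lemma taylorRelation_pointingExponent (hΓ : Γ.IsTree) (e : Γ.Dart) :
    taylorRelation K Γ.pointingExponent e.fst e.snd
      = Pi.single e.snd (X e.symm) - Pi.single e.fst (X e) := by
  have h1 := hΓ.isAcyclic.inf_pointingExponent_add_single e
  have h2 := hΓ.isAcyclic.inf_pointingExponent_add_single e.symm
  change Γ.pointingExponent e.snd ⊓ Γ.pointingExponent e.fst + _ = Γ.pointingExponent e.fst at h2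
  rw [inf_comm] at h2
  rw [taylorRelation, tsub_eq_of_eq_add_rev h1.symm, tsub_eq_of_eq_add_rev h2.symm]
  rfl

theorem isHilbertBurchMatrix_genericMatrix (hΓ : Γ.IsTree) {d : Fin m → Γ.Dart}
    (hd : IsEdgeOrdering d) (hlt : ∀ k, (d k).fst < (d k).snd) :
    IsHilbertBurchMatrix Γ.pointingExponent (genericMatrix K d) where
  row_taylor k := ⟨_, _, hlt k, by
    rw [genericMatrix_row, taylorRelation_pointingExponent K hΓ]⟩
  linearIndependent := linearIndependent_genericMatrix K hΓ hd
  span_eq := span_genericMatrix K hΓ hd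

/-- Reversing a dart negates its row, while Taylor relations are normalised by `i < j`; only the
increasing orientation gives a Hilbert–Burch matrix on the nose. -/
lemma IsEdgeOrdering.exists_lt {d : Fin m → Γ.Dart} (hd : IsEdgeOrdering d) :
    ∃ d' : Fin m → Γ.Dart, IsEdgeOrdering d' ∧ ∀ k, (d' k).fst < (d' k).snd := by
  have h : ∀ k, ∃ e : Γ.Dart, e.edge = (d k).edge ∧ e.fst < e.snd := fun k => by
    rcases lt_or_gt_of_ne (d k).fst_ne_snd with h | h
    exacts [⟨d k, rfl, h⟩, ⟨(d k).symm, by simp, h⟩]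
  choose d' hd' hlt using h
  refine ⟨d', ?_, hlt⟩
  unfold IsEdgeOrdering
  simp only [hd']
  exact hd

theorem relationGraph_eq_of_isHilbertBurchMatrix (hΓ : Γ.IsTree) {d : Fin m → Γ.Dart}
    (hd : IsEdgeOrdering d) {A : Matrix (Fin m) (Fin (m + 1)) (MvPolynomial Γ.Dart K)}
    (hA : IsHilbertBurchMatrix Γ.pointingExponent A) : relationGraph A = Γ := by
  have h : ∀ k, ∃ r, ∀ l, A r l ≠ 0 ↔ l = (d k).fst ∨ l = (d k).snd := fun k => by
    refine exists_taylorRelation_of_mem_span Γ.pointingExponent (s := Finsupp.single (d k) 1)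
      (fun l hl => hΓ.eq_or_eq_of_pointingExponent_le hl) hA.row_taylor
      (f := genericMatrix K d k) ?_ ?_
    · exact hA.span_eq ▸ genericMatrix_mem_relationModule K hΓ d k
    · simp [genericMatrix]
  choose r hr using h
  -- The support of a row determines the edge. Since edges and rows are both indexed by `Fin m`, `r`
  -- is then onto and no row is left for a non-edge.
  have hinj : Function.Injective r := fun k l hkl => by
    refine hd.eq_of_edge_eq (Sym2.ext fun x => ?_)
    have h1 := hr k x
    rw [hkl, hr l x] at h1
    change x ∈ s(_, _) ↔ x ∈ s(_, _)
    rw [Sym2.mem_iff, Sym2.mem_iff]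
    exact h1.symm
  ext i j
  constructor
  · rintro ⟨hij, k, hk⟩
    obtain ⟨k, rfl⟩ := Finite.surjective_of_injective hinj k
    have hi := (hr k i).1 ((hk i).2 (.inl rfl))
    have hj := (hr k j).1 ((hk j).2 (.inr rfl))
    have hadj := (d k).adj
    rcases hi with rfl | rfl <;> rcases hj with rfl | rfl
    exacts [(hij rfl).elim, hadj, hadj.symm, (hij rfl).elim]
  · intro hij
    obtain ⟨k, hk⟩ := hd.exists_edge_eq ⟨(i, j), hij⟩
    refine ⟨hij.ne, r k, fun l => (hr k l).trans ?_⟩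
    rw [← Sym2.mem_iff, ← Sym2.mem_iff]
    exact iff_of_eq (congrArg (l ∈ ·) hk)

theorem isMinimalMonomialGenerators_genericIdeal (hΓ : Γ.IsTree) {d : Fin m → Γ.Dart}
    (hd : IsEdgeOrdering d) :
    IsMinimalMonomialGenerators (genericIdeal K d) Γ.pointingExponent where
  span_eq := by
    choose c hc using exists_genericMinor_eq K hΓ hd
    have key : ∀ j, ∃ w : MvPolynomial Γ.Dart K, w * w = 1 ∧
        genericMinor K d j = w * monomial (Γ.pointingExponent j) 1 := fun j => by
      rcases Int.units_eq_one_or (c j) with h | h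
      · exact ⟨1, by simp, by simp [hc, h]⟩
      · exact ⟨-1, by simp, by simp [hc, h]⟩
    refine le_antisymm (Ideal.span_le.2 ?_) (Ideal.span_le.2 ?_)
    · rintro _ ⟨j, rfl⟩
      obtain ⟨w, -, h⟩ := key j
      rw [h]
      exact Ideal.mul_mem_left _ _ (Ideal.subset_span ⟨j, rfl⟩)
    · rintro _ ⟨j, rfl⟩
      obtain ⟨w, hw, h⟩ := key j
      have := Ideal.mul_mem_left (genericIdeal K d) w (Ideal.subset_span ⟨j, rfl⟩)
      rwa [h, ← mul_assoc, hw, one_mul] at this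
  antichain _ _ h := hΓ.eq_of_pointingExponent_le h

end GenericMatrix
end

theorem proposition2p1 {K : Type*} [Field K] {m : ℕ} (Γ : SimpleGraph (Fin (m + 1)))
    (hΓ : Γ.IsTree) (d : Fin m → Γ.Dart) (hd : IsEdgeOrdering d) :
    ∃ u : Fin (m + 1) → Γ.Dart →₀ ℕ,
      (∀ j, genericMinor K d j = monomial (u j) 1 ∨ genericMinor K d j = -monomial (u j) 1) ∧
      IsMinimalMonomialGenerators (genericIdeal K d) u ∧
      relationTrees (genericIdeal K d) u = {Γ} := by
  have hmin := isMinimalMonomialGenerators_genericIdeal K hΓ hd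
  refine ⟨Γ.pointingExponent, fun j => ?_, hmin, Set.eq_singleton_iff_unique_mem.2 ⟨?_, ?_⟩⟩
  · obtain ⟨c, hc⟩ := exists_genericMinor_eq K hΓ hd j
    rcases Int.units_eq_one_or c with rfl | rfl
    · exact .inl (by simpa using hc)
    · exact .inr (by simpa using hc)
  · obtain ⟨d', hd', hlt⟩ := hd.exists_lt
    have hA := isHilbertBurchMatrix_genericMatrix K hΓ hd' hlt
    exact ⟨hmin, _, hA, (relationGraph_eq_of_isHilbertBurchMatrix K hΓ hd' hA).symm⟩
  · rintro _ ⟨-, A, hA, rfl⟩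
    exact relationGraph_eq_of_isHilbertBurchMatrix K hΓ hd hA
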